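/- **Conventions.** A permutation of length $n$ is a word containing each of $1,\dots,n$ exactly once. The standardization $\mathrm{st}[s]$ of a word $s$ with distinct letters is the permutation with the same length and the same relative order of letters. An occurrence of a permutation $\pi$ of length $l$ in a permutation $\sigma$ of length $n$ is a position $i$, $1\le i\le n-l+1$, with $\mathrm{st}[\sigma(i)\ldots\sigma(i+l-1)]=\pi$; $\pi$ divides $\sigma$ if it has an occurrence in $\sigma$. A collection of patterns is a set of permutations (of possibly different lengths) none of which divides another one. Two collections $\Pi_1,\Pi_2$ are strongly c-Wilf equivalent if for all integers $n\ge 1$ and $0\le q<n$ the number of permutations of length $n$ with exactly $q$ occurrences of patterns from $\Pi_1$ equals the number of those with exactly $q$ occurrences of patterns from $\Pi_2$. Let $\pi,\pi'$ be permutations of lengths $l,l'$. A linkage of $(\pi,\pi')$ of length $n$ is a permutation $\sigma$ of length $n$ with $\max(l,l')\le n<l+l'$, $\mathrm{st}[\sigma(1)\ldots\sigma(l)]=\pi$ and $\mathrm{st}[\sigma(n-l'+1)\ldots\sigma(n)]=\pi'$. For $1\le k\le\min(l,l')$ the pair $(\pi,\pi')$ $k$-overlaps if $\mathrm{st}[\pi(l-k+1)\ldots\pi(l)]=\mathrm{st}[\pi'(1)\ldots\pi'(k)]$.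 A collection $\Pi$ is monotone if, whenever $\pi,\pi'\in\Pi$ (not necessarily distinct) $k$-overlap, all of $\pi'(1),\dots,\pi'(k)$ are at most $k$. **Corollary 3.4 (monotone collections).** Let $\Pi_1$ and $\Pi_2$ be monotone collections of patterns, and suppose that there is a bijection $\varphi:\Pi_1\to\Pi_2$ such that * (lengths) $\pi$ and $\varphi(\pi)$ have the same length for every $\pi\in\Pi_1$; * (linkages) for all $\pi,\pi'\in\Pi_1$ and all $n$, the pair $(\pi,\pi')$ has a linkage of length $n$ if and only if $(\varphi(\pi),\varphi(\pi'))$ has a linkage of length $n$; * (maxima of overlapping sets) whenever $\pi,\pi'\in\Pi_1$ $k$-overlap and $l$ is the length of $\pi$, $$\max\{\pi(l-k+1),\ldots,\pi(l)\}=\max\{\varphi(\pi)(l-k+1),\ldots,\varphi(\pi)(l)\}.$$ Then $\Pi_1$ and $\Pi_2$ are strongly c-Wilf equivalent. (Moreover, whenever $\pi,\pi'\in\Pi_1$ $k$-overlap, $\{\pi'(1),\ldots,\pi'(k)\}=\{\varphi(\pi')(1),\ldots,\varphi(\pi')(k)\}=\{1,\ldots,k\}$.) -/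

import Mathlib

namespace CWilf

/-- A permutation `(π(1) … π(l))` of some length `l`, stored with 0-based positions and values.
All words below are read off with the 1-based values `1, …, l`, through `entry`. -/
abbrev Pattern : Type := Σ l : ℕ, Equiv.Perm (Fin l)

/-- The length of a permutation. -/
abbrev len (π : Pattern) : ℕ := π.1

/-- The entry (in `{1, …, l}`) of a permutation at the 0-based position `i`. -/
def entry {l : ℕ} (π : Equiv.Perm (Fin l)) (i : Fin l) : ℕ := (π i : ℕ) + 1

/-- The consecutive subword with `m` letters of `σ` that starts after its first `d` letters. -/
def window {n : ℕ} (σ : Equiv.Perm (Fin n)) (d m : ℕ) (h : d + m ≤ n) : Fin m → ℕ :=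
  fun i => entry σ ⟨d + i, by have := i.isLt; omega⟩

/-- The standardization of a word: each letter is replaced by its rank among all letters. -/
def st {m : ℕ} (s : Fin m → ℕ) : Fin m → ℕ :=
  fun i => (Finset.univ.filter fun j => s j < s i).card + 1

/-- The standardization has the same relative order as the word. -/
theorem st_lt_st_iff {m : ℕ} (s : Fin m → ℕ) (i j : Fin m) : st s i < st s j ↔ s i < s j := by
  have mono : ∀ a b : Fin m, s a ≤ s b → st s a ≤ st s b := by
    intro a b hab
    refine Nat.succ_le_succ (Finset.card_le_card fun x hx => ?_)
    simp only [Finset.mem_filter, Finset.mem_univ, true_and] at hx ⊢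
    omega
  constructor
  · intro h
    by_contra hn
    exact absurd (mono j i (by omega)) (by omega)
  · intro h
    refine Nat.succ_lt_succ (Finset.card_lt_card ?_)
    refine (Finset.ssubset_iff_of_subset fun x hx => ?_).2 ⟨i, by simpa using h, by simp⟩
    simp only [Finset.mem_filter, Finset.mem_univ, true_and] at hx ⊢
    omega

/-- `π` occurs in `σ` as a consecutive pattern, starting after the first `d` letters of `σ`. -/
def OccursAt (π : Pattern) {n : ℕ} (σ : Equiv.Perm (Fin n)) (d : ℕ) : Prop :=
  ∃ h : d + len π ≤ n, st (window σ d (len π) h) = entry π.2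

/-- `π` divides `σ`. -/
def Divides (π σ : Pattern) : Prop := ∃ d : ℕ, OccursAt π σ.2 d

/-- A collection is reduced when no member divides another member. -/
def IsReduced (P : Set Pattern) : Prop :=
  ∀ π ∈ P, ∀ π' ∈ P, Divides π π' → π = π'

/-- The occurrences in `σ` of members of `P`, as pairs (member, position). -/
def occurrences (P : Set Pattern) {n : ℕ} (σ : Equiv.Perm (Fin n)) : Set (Pattern × ℕ) :=
  {x | x.1 ∈ P ∧ OccursAt x.1 σ x.2}

theorem occurrences_finite (P : Set Pattern) {n : ℕ} (σ : Equiv.Perm (Fin n)) :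
    (occurrences P σ).Finite := by
  have hfin : (Set.range fun y : (Σ l : Fin (n + 1), Equiv.Perm (Fin (l : ℕ))) × Fin (n + 1) =>
      ((⟨(y.1.1 : ℕ), y.1.2⟩ : Pattern), (y.2 : ℕ))).Finite := Set.finite_range _
  refine hfin.subset ?_
  rintro ⟨⟨l, π⟩, d⟩ ⟨-, h, -⟩
  simp only [len] at h
  exact ⟨(⟨⟨l, by omega⟩, π⟩, ⟨d, by omega⟩), rfl⟩

/-- The number of permutations of length `n` with exactly `q` occurrences of members of `P`. -/
noncomputable def countWith (P : Set Pattern) (n q : ℕ) : ℕ :=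
  {σ : Equiv.Perm (Fin n) | (occurrences P σ).ncard = q}.ncard

/-- Strong c-Wilf equivalence. -/
def StronglyCWilfEquivalent (P Q : Set Pattern) : Prop :=
  ∀ n : ℕ, 0 < n → ∀ q : ℕ, q < n → countWith P n q = countWith Q n q

/-- `σ` (of length `n`) is a linkage of the ordered pair `(π, π')`: the patterns `π` and `π'` are
the standardizations of its first `l` and last `l'` letters, and `n < l + l'`. -/
def IsLinkage (π π' : Pattern) {n : ℕ} (σ : Equiv.Perm (Fin n)) : Prop :=
  n < len π + len π' ∧ len π ≤ n ∧ len π' ≤ n ∧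
    OccursAt π σ 0 ∧ OccursAt π' σ (n - len π')

/-- The pair `(π, π')` has a linkage of length `n`. -/
def HasLinkage (π π' : Pattern) (n : ℕ) : Prop :=
  ∃ σ : Equiv.Perm (Fin n), IsLinkage π π' σ

/-- The pair `(π, π')` has a `k`-overlapping: the last `k` letters of `π` and the first `k`
letters of `π'` have the same standardization. -/
def HasOverlap (π π' : Pattern) (k : ℕ) : Prop :=
  0 < k ∧ ∃ (h : k ≤ len π) (h' : k ≤ len π'),
    st (window π.2 (len π - k) k (Nat.sub_add_cancel h).le) =
      st (window π'.2 0 k ((Nat.zero_add k).le.trans h'))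

/-- The set of the first `k` entries of `π`. -/
def initialSet (π : Pattern) (k : ℕ) : Finset ℕ :=
  (Finset.univ.filter fun i : Fin (len π) => (i : ℕ) < k).image (entry π.2)

/-- The set of the last `k` entries of `π`. -/
def finalSet (π : Pattern) (k : ℕ) : Finset ℕ :=
  (Finset.univ.filter fun i : Fin (len π) => len π ≤ (i : ℕ) + k).image (entry π.2)

/-- A collection is monotone when every `k`-overlapping of two of its members `(π, π')` forces
the first `k` entries of `π'` to be at most `k`. -/
def IsMonotone (P : Set Pattern) : Prop :=
  ∀ π ∈ P, ∀ π' ∈ P, ∀ k : ℕ, HasOverlap π π' k → ∀ e ∈ initialSet π' k, e ≤ k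

end CWilf

/-! By inclusion-exclusion, the distribution of the number of occurrences depends only on how many
permutations contain each finite set `S` of prescribed occurrences (pattern, position). It therefore
suffices that replacing every pattern of `S` by its image under `φ` preserves this number;
`card_occursAt_le` gives one inequality, and its application to `φ.symm` the other.

The underlying injection is composition with a single permutation of positions that depends only on
`S`. Each window splits into a prefix covered by earlier windows and a fresh block. By monotonicity
the old and the new pattern both put their smallest values in the prefix, so letters can be moved
inside each block separately (`rearrange`). Induction over the windows (`sameOrder_rearrange`) shows
that the new patterns appear: inside a block by construction, inside a prefix by inheritance from an
earlier window. Prefix letters stay below block letters because, by equality of maxima, the largest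
new prefix letter already was a prefix letter.

Overlaps pass to the images because, under monotonicity, a `k`-overlap amounts to a linkage of
length `l + l' - k` (`hasOverlap_map`). -/

namespace CWilf

open Finset

/-! ### From inclusion counts to exact counts -/

/-- Binomial expansion of `X = (X - 1) + 1`, then exchange of the two sums. -/
theorem sum_pow_card_eq {α ι : Type*} [Fintype α] [DecidableEq ι] (f : α → Finset ι)
    (U : Finset ι) (hU : ∀ a, f a ⊆ U) :
    ∑ a, (Polynomial.X : Polynomial ℤ) ^ (f a).card =
      ∑ S ∈ U.powerset, ((univ.filter fun a => S ⊆ f a).card : Polynomial ℤ) *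
        (Polynomial.X - 1) ^ S.card := by
  have key : ∀ a, (Polynomial.X : Polynomial ℤ) ^ (f a).card =
      ∑ S ∈ U.powerset, if S ⊆ f a then (Polynomial.X - 1) ^ S.card else 0 := by
    intro a
    have h := Finset.sum_pow_mul_eq_add_pow (Polynomial.X - 1 : Polynomial ℤ) 1 (f a)
    rw [sub_add_cancel] at h
    rw [← h, ← Finset.sum_filter]
    refine Finset.sum_congr ?_ fun S _ => by simp
    ext S
    simp only [mem_powerset, mem_filter]
    exact ⟨fun h => ⟨h.trans (hU a), h⟩, fun h => h.2⟩
  simp_rw [key]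
  rw [Finset.sum_comm]
  refine Finset.sum_congr rfl fun S _ => ?_
  rw [← Finset.sum_filter, Finset.sum_const, nsmul_eq_mul]

/-- Two families of finite sets in which every finite set is contained equally often have the
same distribution of cardinalities. -/
theorem card_filter_card_eq {α ι : Type*} [Fintype α] [DecidableEq ι] (f g : α → Finset ι)
    (h : ∀ S : Finset ι, (univ.filter fun a => S ⊆ f a).card = (univ.filter fun a => S ⊆ g a).card)
    (q : ℕ) :
    (univ.filter fun a => (f a).card = q).card = (univ.filter fun a => (g a).card = q).card := by
  have hs : ∑ a, (Polynomial.X : Polynomial ℤ) ^ (f a).card =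
      ∑ a, (Polynomial.X : Polynomial ℤ) ^ (g a).card := by
    -- The union of all members of both families serves as a common finite index set.
    rw [sum_pow_card_eq f (univ.biUnion f ∪ univ.biUnion g)
        fun a => (subset_biUnion_of_mem f (mem_univ a)).trans subset_union_left,
      sum_pow_card_eq g (univ.biUnion f ∪ univ.biUnion g)
        fun a => (subset_biUnion_of_mem g (mem_univ a)).trans subset_union_right]
    exact Finset.sum_congr rfl fun S _ => by rw [h S]
  have hc := congrArg (fun p => Polynomial.coeff p q) hs
  simp only [Polynomial.finsetSum_coeff, Polynomial.coeff_X_pow, Finset.sum_boole] at hc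
  have hc' : (univ.filter fun a => q = (f a).card).card =
      (univ.filter fun a => q = (g a).card).card := by exact_mod_cast hc
  simpa only [eq_comm] using hc'

/-! ### Permutations as words indexed by the natural numbers -/

/-- An injective self-map of a finite initial segment is onto it, so nothing from outside can enter.
-/
theorem perm_lt_iff_of_mapsTo (e : Equiv.Perm ℕ) {k : ℕ} (h : ∀ i < k, e i < k) (i : ℕ) :
    e i < k ↔ i < k := by
  refine ⟨fun hi => ?_, h i⟩
  have himg : (range k).image e = range k := by
    refine eq_of_subset_of_card_le (fun x hx => ?_) ?_
    · obtain ⟨j, hj, rfl⟩ := mem_image.1 hx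
      exact mem_range.2 (h j (mem_range.1 hj))
    · rw [card_image_of_injective _ e.injective]
  have : e i ∈ (range k).image e := by rw [himg]; exact mem_range.2 hi
  obtain ⟨j, hj, hji⟩ := mem_image.1 this
  rw [← e.injective hji]
  exact mem_range.1 hj

/-- The extension of a permutation of `Fin l` by the identity. -/
def extend {l : ℕ} (π : Equiv.Perm (Fin l)) : Equiv.Perm ℕ :=
  π.extendDomain (Fin.equivSubtype (n := l))

theorem extend_apply {l : ℕ} (π : Equiv.Perm (Fin l)) {i : ℕ} (hi : i < l) :
    extend π i = π ⟨i, hi⟩ :=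
  Equiv.Perm.extendDomain_apply_subtype π Fin.equivSubtype hi

theorem extend_fin {l : ℕ} (π : Equiv.Perm (Fin l)) (i : Fin l) : extend π i = π i :=
  extend_apply π i.isLt

theorem extend_lt_iff {l : ℕ} (π : Equiv.Perm (Fin l)) (i : ℕ) : extend π i < l ↔ i < l :=
  perm_lt_iff_of_mapsTo _ (fun j hj => by rw [extend_apply π hj]; exact (π _).isLt) i

theorem st_eq_st_iff {m : ℕ} (s t : Fin m → ℕ) :
    st s = st t ↔ ∀ i j, s i < s j ↔ t i < t j := by
  constructor
  · intro h i j
    rw [← st_lt_st_iff s, ← st_lt_st_iff t, h]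
  · intro h
    funext i
    simp only [st, h]

theorem st_entry {l : ℕ} (π : Equiv.Perm (Fin l)) : st (entry π) = entry π := by
  funext i
  have h : (univ.filter fun j => entry π j < entry π i) =
      (univ.filter fun j => j < π i).map π.symm.toEmbedding := by
    ext j
    simp [entry, Finset.mem_map_equiv]
  simp only [st, h, card_map]
  rw [Finset.filter_gt_eq_Iio, Fin.card_Iio]
  rfl

/-- The word `f` has, at the `l` positions following `d`, the same relative order as `a`. -/
def SameOrder (a : ℕ → ℕ) (l : ℕ) (f : ℕ → ℕ) (d : ℕ) : Prop :=
  ∀ i < l, ∀ j < l, f (d + i) < f (d + j) ↔ a i < a j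

theorem occursAt_iff (π : Pattern) {n : ℕ} (σ : Equiv.Perm (Fin n)) (d : ℕ) :
    OccursAt π σ d ↔ d + len π ≤ n ∧ SameOrder (extend π.2) (len π) (extend σ) d := by
  unfold OccursAt
  rw [← exists_prop]
  refine exists_congr fun h => ?_
  rw [← st_entry π.2, st_eq_st_iff]
  constructor
  · intro H i hi j hj
    have := H ⟨i, hi⟩ ⟨j, hj⟩
    rw [extend_apply σ (i := d + i) (by omega), extend_apply σ (i := d + j) (by omega),
      extend_apply π.2 hi, extend_apply π.2 hj]
    simpa [window, entry] using this
  · intro H i j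
    have := H i i.isLt j j.isLt
    rw [extend_apply σ (i := d + i) (by omega), extend_apply σ (i := d + j) (by omega),
      extend_fin, extend_fin] at this
    simpa [window, entry] using this

theorem hasOverlap_iff (π π' : Pattern) (k : ℕ) :
    HasOverlap π π' k ↔ 0 < k ∧ k ≤ len π ∧ k ≤ len π' ∧
      SameOrder (extend π'.2) k (extend π.2) (len π - k) := by
  unfold HasOverlap
  refine and_congr_right fun _ => ?_
  rw [← exists_prop]
  refine exists_congr fun h => ?_
  rw [← exists_prop]
  refine exists_congr fun h' => ?_
  rw [st_eq_st_iff]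
  have e1 : ∀ i (hi : i < k), window π.2 (len π - k) k (Nat.sub_add_cancel h).le ⟨i, hi⟩ =
      extend π.2 (len π - k + i) + 1 := fun i hi => by
    rw [extend_apply π.2 (show len π - k + i < len π by omega)]; rfl
  have e2 : ∀ i (hi : i < k), window π'.2 0 k ((Nat.zero_add k).le.trans h') ⟨i, hi⟩ =
      extend π'.2 i + 1 := fun i hi => by
    rw [extend_apply π'.2 (show i < len π' by omega)]; simp [window, entry]
  constructor
  · intro H i hi j hj
    have := H ⟨i, hi⟩ ⟨j, hj⟩
    rw [e1, e1, e2, e2] at this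
    simpa using this
  · intro H i j
    have := H i i.isLt j j.isLt
    have a1 := e1 i i.isLt
    have a2 := e1 j j.isLt
    have a3 := e2 i i.isLt
    have a4 := e2 j j.isLt
    simp only [Fin.eta] at a1 a2 a3 a4
    rw [a1, a2, a3, a4]
    simpa using this

theorem mem_initialSet {π : Pattern} {k e : ℕ} :
    e ∈ initialSet π k ↔ ∃ i < len π, i < k ∧ extend π.2 i + 1 = e := by
  simp only [initialSet, mem_image, mem_filter, mem_univ, true_and, entry]
  constructor
  · rintro ⟨i, hi, rfl⟩
    exact ⟨i, i.isLt, hi, by rw [extend_fin]⟩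
  · rintro ⟨i, hl, hi, rfl⟩
    exact ⟨⟨i, hl⟩, hi, by rw [extend_apply π.2 hl]⟩

theorem mem_finalSet {π : Pattern} {k e : ℕ} :
    e ∈ finalSet π k ↔ ∃ i < len π, len π ≤ i + k ∧ extend π.2 i + 1 = e := by
  simp only [finalSet, mem_image, mem_filter, mem_univ, true_and, entry]
  constructor
  · rintro ⟨i, hi, rfl⟩
    exact ⟨i, i.isLt, hi, by rw [extend_fin]⟩
  · rintro ⟨i, hl, hi, rfl⟩
    exact ⟨⟨i, hl⟩, hi, by rw [extend_apply π.2 hl]⟩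

theorem IsMonotone.extend_lt {P : Set Pattern} (hP : IsMonotone P) {π π' : Pattern} (hπ : π ∈ P)
    (hπ' : π' ∈ P) {k : ℕ} (h : HasOverlap π π' k) : ∀ i < k, extend π'.2 i < k := by
  intro i hi
  have hk := ((hasOverlap_iff π π' k).1 h).2.2.1
  exact hP π hπ π' hπ' k h _ (mem_initialSet.2 ⟨i, by omega, hi, rfl⟩)

theorem IsMonotone.initialSet_eq {P : Set Pattern} (hP : IsMonotone P) {π π' : Pattern}
    (hπ : π ∈ P) (hπ' : π' ∈ P) {k : ℕ} (h : HasOverlap π π' k) : initialSet π' k = Icc 1 k := by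
  have hk := ((hasOverlap_iff π π' k).1 h).2.2.1
  have hlt := perm_lt_iff_of_mapsTo _ (hP.extend_lt hπ hπ' h)
  ext e
  rw [mem_initialSet, mem_Icc]
  constructor
  · rintro ⟨i, _, hi, rfl⟩
    have := (hlt i).2 hi
    omega
  · rintro ⟨h1, h2⟩
    have := (hlt ((extend π'.2).symm (e - 1))).1 (by rw [Equiv.apply_symm_apply]; omega)
    exact ⟨_, by omega, this, by rw [Equiv.apply_symm_apply]; omega⟩

/-! ### Overlaps and linkages -/

theorem hasOverlap_of_occursAt {π π' : Pattern} {n : ℕ} {σ : Equiv.Perm (Fin n)} {d d' k : ℕ}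
    (h : OccursAt π σ d) (h' : OccursAt π' σ d') (hk : 0 < k) (hkl : k ≤ len π)
    (hkl' : k ≤ len π') (hd : d' + k = d + len π) : HasOverlap π π' k := by
  rw [occursAt_iff] at h h'
  rw [hasOverlap_iff]
  refine ⟨hk, hkl, hkl', fun i hi j hj => ?_⟩
  rw [← h.2 (len π - k + i) (by omega) (len π - k + j) (by omega),
    ← h'.2 i (by omega) j (by omega)]
  rw [show d + (len π - k + i) = d' + i by omega, show d + (len π - k + j) = d' + j by omega]

theorem HasLinkage.hasOverlap {π π' : Pattern} {k : ℕ} (hkl : k ≤ len π)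
    (hkl' : k ≤ len π') (h : HasLinkage π π' (len π + len π' - k)) : HasOverlap π π' k := by
  obtain ⟨σ, h1, h2, h3, h4, h5⟩ := h
  exact hasOverlap_of_occursAt h4 h5 (by omega) hkl hkl' (by omega)

theorem exists_perm_extend_eq {n : ℕ} (f : ℕ → ℕ) (hf : ∀ i < n, f i < n)
    (hinj : ∀ i < n, ∀ j < n, f i = f j → i = j) :
    ∃ σ : Equiv.Perm (Fin n), ∀ i < n, extend σ i = f i := by
  let g : Fin n → Fin n := fun i => ⟨f i, hf i i.isLt⟩
  have hg : Function.Injective g := fun i j hij =>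
    Fin.ext (hinj i i.isLt j j.isLt (congrArg Fin.val hij))
  exact ⟨Equiv.ofBijective g hg.bijective_of_finite, fun i hi => by rw [extend_apply _ hi]; rfl⟩

/-- Keep `π` as it stands and append the last letters of `π'`, shifted by `len π - k`. Monotonicity
makes these at least `k` before the shift, hence above all of `π` after it. -/
theorem HasOverlap.hasLinkage {π π' : Pattern} {k : ℕ} (h : HasOverlap π π' k)
    (hlt : ∀ i < k, extend π'.2 i < k) : HasLinkage π π' (len π + len π' - k) := by
  obtain ⟨hk, hkl, hkl', hov⟩ := (hasOverlap_iff π π' k).1 h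
  have hlt' := perm_lt_iff_of_mapsTo _ hlt
  have hb : ∀ i, extend π.2 i < len π ↔ i < len π := extend_lt_iff π.2
  have hb' : ∀ i, extend π'.2 i < len π' ↔ i < len π' := extend_lt_iff π'.2
  obtain ⟨σ, hσ⟩ := exists_perm_extend_eq (n := len π + len π' - k)
    (fun x => if x < len π then extend π.2 x
      else extend π'.2 (x - (len π - k)) + (len π - k))
    (by
      intro i hi
      have h1 := hb i
      have h2 := hb' (i - (len π - k))
      split_ifs <;> omega)
    (by
      intro i hi j hj hij
      have h1 := hb i
      have h2 := hlt' (i - (len π - k))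
      have h3 := hb j
      have h4 := hlt' (j - (len π - k))
      split_ifs at hij with hi' hj' hj'
      · exact (extend π.2).injective hij
      · omega
      · omega
      · have := (extend π'.2).injective (Nat.add_right_cancel hij)
        omega)
  refine ⟨σ, by omega, by omega, by omega, ?_, ?_⟩
  · refine (occursAt_iff _ _ _).2 ⟨by omega, fun i hi j hj => ?_⟩
    rw [hσ _ (by omega), hσ _ (by omega), zero_add, zero_add, if_pos hi, if_pos hj]
  · refine (occursAt_iff _ _ _).2 ⟨by omega, fun i hi j hj => ?_⟩
    rw [show len π + len π' - k - len π' = len π - k by omega, hσ _ (by omega), hσ _ (by omega)]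
    have h1 := hlt' i
    have h3 := hlt' j
    have h2 := hb (len π - k + i)
    have h4 := hb (len π - k + j)
    rw [show len π - k + i - (len π - k) = i by omega,
      show len π - k + j - (len π - k) = j by omega]
    split_ifs with hi' hj' hj'
    · exact hov i (by omega) j (by omega)
    · omega
    · omega
    · omega

theorem divides_of_occursAt {π π' : Pattern} {n : ℕ} {σ : Equiv.Perm (Fin n)} {d d' : ℕ}
    (h : OccursAt π σ d) (h' : OccursAt π' σ d') (hd : d ≤ d')
    (hdl : d' + len π' ≤ d + len π) : Divides π' π := by
  rw [occursAt_iff] at h h'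
  refine ⟨d' - d, (occursAt_iff _ _ _).2 ⟨by have := h.1; change _ ≤ len π; omega,
    fun i hi j hj => ?_⟩⟩
  rw [← h'.2 i hi j hj, ← h.2 (d' - d + i) (by omega) (d' - d + j) (by omega),
    show d + (d' - d + i) = d' + i by omega, show d + (d' - d + j) = d' + j by omega]

/-! ### Transport of a word along a rank-preserving rearrangement of its windows -/

section Transport

variable {ι : Type*} (S : Finset ι) (l d : ι → ℕ)

/-- The number of letters of the window of `s` covered by the windows that start earlier. -/
def overlap (s : ι) : ℕ := S.sup fun p => if d p < d s then d p + l p - d s else 0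

theorem le_overlap {s p : ι} (hp : p ∈ S) (h : d p < d s) : d p + l p - d s ≤ overlap S l d s := by
  have := Finset.le_sup (f := fun p => if d p < d s then d p + l p - d s else 0) hp
  simpa only [overlap, if_pos h] using this

theorem exists_overlap_eq {s : ι} (h : 0 < overlap S l d s) :
    ∃ p ∈ S, d p < d s ∧ d p + l p = d s + overlap S l d s := by
  have hne : S.Nonempty := by
    rw [Finset.nonempty_iff_ne_empty]
    rintro rfl
    simp [overlap] at h
  obtain ⟨p, hp, he⟩ := Finset.exists_mem_eq_sup S hne
    fun p => if d p < d s then d p + l p - d s else 0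
  change overlap S l d s = _ at he
  split_ifs at he with hd
  · exact ⟨p, hp, hd, by omega⟩
  · omega

variable (a b : ι → Equiv.Perm ℕ)

open Classical in
/-- The rearrangement of positions that sends the position of a given rank for `b s` in the
uncovered part of the window of `s` to the position of the same rank for `a s`. -/
noncomputable def rearrange (x : ℕ) : ℕ :=
  if h : ∃ s ∈ S, d s + overlap S l d s ≤ x ∧ x < d s + l s then
    d h.choose + (a h.choose).symm (b h.choose (x - d h.choose))
  else x

variable {S l d a b}

/-- Fresh blocks are disjoint: the block of a later window starts only after all earlier windows
have ended. -/
theorem eq_of_mem_block (hd : ∀ s ∈ S, ∀ t ∈ S, d s = d t → s = t) {s t : ι} (hs : s ∈ S)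
    (ht : t ∈ S) {x : ℕ} (hsx : d s + overlap S l d s ≤ x ∧ x < d s + l s)
    (htx : d t + overlap S l d t ≤ x ∧ x < d t + l t) : s = t := by
  rcases lt_trichotomy (d s) (d t) with h | h | h
  · have := le_overlap S l d hs h; omega
  · exact hd s hs t ht h
  · have := le_overlap S l d ht h; omega

theorem rearrange_of_mem_block (hd : ∀ s ∈ S, ∀ t ∈ S, d s = d t → s = t) {s : ι} (hs : s ∈ S)
    {i : ℕ} (hi : overlap S l d s ≤ i) (hil : i < l s) :
    rearrange S l d a b (d s + i) = d s + (a s).symm (b s i) := by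
  have h : ∃ t ∈ S, d t + overlap S l d t ≤ d s + i ∧ d s + i < d t + l t :=
    ⟨s, hs, by omega, by omega⟩
  have he : h.choose = s :=
    eq_of_mem_block hd h.choose_spec.1 hs h.choose_spec.2 ⟨by omega, by omega⟩
  rw [rearrange, dif_pos h, he, Nat.add_sub_cancel_left]

theorem rearrange_of_forall_not_mem {x : ℕ}
    (h : ¬ ∃ s ∈ S, d s + overlap S l d s ≤ x ∧ x < d s + l s) :
    rearrange S l d a b x = x := dif_neg h

/-- The properties of two families of patterns, placed at the same positions, that make
`rearrange` turn matches of the first family into matches of the second one. -/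
structure Compatible (S : Finset ι) (l d : ι → ℕ) (a b : ι → Equiv.Perm ℕ) : Prop where
  inj : ∀ s ∈ S, ∀ t ∈ S, d s = d t → s = t
  end_lt : ∀ s ∈ S, ∀ t ∈ S, d s < d t → d s + l s < d t + l t
  lt_left : ∀ s ∈ S, ∀ i, a s i < l s ↔ i < l s
  lt_right : ∀ s ∈ S, ∀ i, b s i < l s ↔ i < l s
  init_left : ∀ s ∈ S, ∀ t ∈ S, ∀ k, 0 < k → d s < d t → d s + l s = d t + k → ∀ i < k, a t i < k
  init_right : ∀ s ∈ S, ∀ t ∈ S, ∀ k, 0 < k → d s < d t → d s + l s = d t + k → ∀ i < k, b t i < k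
  overlap_right : ∀ s ∈ S, ∀ t ∈ S, ∀ k, 0 < k → d s < d t → d s + l s = d t + k →
    SameOrder (b t) k (b s) (l s - k)
  max_eq : ∀ s ∈ S, ∀ t ∈ S, ∀ k, 0 < k → d s < d t → d s + l s = d t + k →
    ∀ m, l s - k ≤ m → m < l s → (∀ i, l s - k ≤ i → i < l s → b s i ≤ b s m) →
      ∃ i, l s - k ≤ i ∧ i < l s ∧ a s i = b s m

namespace Compatible

variable (H : Compatible S l d a b)
include H

/-- A nonempty covered prefix is the overlap with some earlier window that attains the supremum, so
the initial-entries condition applies to it. -/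
theorem left_lt_overlap_iff {s : ι} (hs : s ∈ S) (i : ℕ) :
    a s i < overlap S l d s ↔ i < overlap S l d s := by
  refine perm_lt_iff_of_mapsTo _ (fun j hj => ?_) i
  obtain ⟨p, hp, hd, he⟩ := exists_overlap_eq S l d (s := s) (by omega)
  exact H.init_left p hp s hs _ (by omega) hd he j hj

theorem right_lt_overlap_iff {s : ι} (hs : s ∈ S) (i : ℕ) :
    b s i < overlap S l d s ↔ i < overlap S l d s := by
  refine perm_lt_iff_of_mapsTo _ (fun j hj => ?_) i
  obtain ⟨p, hp, hd, he⟩ := exists_overlap_eq S l d (s := s) (by omega)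
  exact H.init_right p hp s hs _ (by omega) hd he j hj

theorem symm_lt {s : ι} (hs : s ∈ S) {i : ℕ} (hi : i < l s) : (a s).symm (b s i) < l s := by
  rw [← H.lt_left s hs, Equiv.apply_symm_apply, H.lt_right s hs]
  exact hi

theorem overlap_le_symm {s : ι} (hs : s ∈ S) {i : ℕ} (hi : overlap S l d s ≤ i) :
    overlap S l d s ≤ (a s).symm (b s i) := by
  rw [← not_lt, ← H.left_lt_overlap_iff hs, Equiv.apply_symm_apply, H.right_lt_overlap_iff hs,
    not_lt]
  exact hi

theorem rearrange_injective : Function.Injective (rearrange S l d a b) := by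
  have hblock : ∀ x, (∃ s ∈ S, d s + overlap S l d s ≤ x ∧ x < d s + l s) →
      ∃ s ∈ S, ∃ i, overlap S l d s ≤ i ∧ i < l s ∧ x = d s + i := by
    rintro x ⟨s, hs, h1, h2⟩
    exact ⟨s, hs, x - d s, by omega, by omega, by omega⟩
  intro x y hxy
  by_cases hx : ∃ s ∈ S, d s + overlap S l d s ≤ x ∧ x < d s + l s <;>
    by_cases hy : ∃ s ∈ S, d s + overlap S l d s ≤ y ∧ y < d s + l s
  · obtain ⟨s, hs, i, hi, hil, rfl⟩ := hblock x hx
    obtain ⟨t, ht, j, hj, hjl, rfl⟩ := hblock y hy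
    rw [rearrange_of_mem_block H.inj hs hi hil, rearrange_of_mem_block H.inj ht hj hjl] at hxy
    have h1 := H.symm_lt hs hil
    have h2 := H.symm_lt ht hjl
    have h3 := H.overlap_le_symm hs hi
    have h4 := H.overlap_le_symm ht hj
    obtain rfl : s = t := eq_of_mem_block H.inj hs ht
      (l := l) (x := d s + (a s).symm (b s i)) ⟨by omega, by omega⟩ ⟨by omega, by omega⟩
    rw [(b s).injective ((a s).symm.injective (Nat.add_left_cancel hxy))]
  · obtain ⟨s, hs, i, hi, hil, rfl⟩ := hblock x hx
    rw [rearrange_of_mem_block H.inj hs hi hil, rearrange_of_forall_not_mem hy] at hxy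
    have h1 := H.symm_lt hs hil
    have h3 := H.overlap_le_symm hs hi
    exact absurd ⟨s, hs, by omega, by omega⟩ hy
  · obtain ⟨t, ht, j, hj, hjl, rfl⟩ := hblock y hy
    rw [rearrange_of_mem_block H.inj ht hj hjl, rearrange_of_forall_not_mem hx] at hxy
    have h1 := H.symm_lt ht hjl
    have h3 := H.overlap_le_symm ht hj
    exact absurd ⟨t, ht, by omega, by omega⟩ hx
  · rwa [rearrange_of_forall_not_mem hx, rearrange_of_forall_not_mem hy] at hxy

theorem rearrange_lt {n : ℕ} (hn : ∀ s ∈ S, d s + l s ≤ n) {x : ℕ} (hx : x < n) :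
    rearrange S l d a b x < n := by
  by_cases h : ∃ s ∈ S, d s + overlap S l d s ≤ x ∧ x < d s + l s
  · obtain ⟨s, hs, h1, h2⟩ := h
    obtain ⟨i, rfl⟩ : ∃ i, x = d s + i := ⟨x - d s, by omega⟩
    rw [rearrange_of_mem_block H.inj hs (by omega) (by omega)]
    have h3 := H.symm_lt hs (i := i) (by omega)
    have h4 := hn s hs
    omega
  · rwa [rearrange_of_forall_not_mem h]

theorem sameOrder_rearrange {f : ℕ → ℕ} (hf : ∀ s ∈ S, SameOrder (a s) (l s) f (d s)) :
    ∀ s ∈ S, SameOrder (b s) (l s) (f ∘ rearrange S l d a b) (d s) := by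
  intro s
  induction hN : d s using Nat.strong_induction_on generalizing s with
  | _ N ih =>
  intro hs
  subst hN
  -- The one place where equality of maxima is needed: `p` is an earlier window reaching furthest
  -- into that of `s`, and `m` is where `b p` is largest on the common letters.
  have hcross : ∀ i j, i < overlap S l d s → overlap S l d s ≤ j → j < l s →
      f (rearrange S l d a b (d s + i)) < f (rearrange S l d a b (d s + j)) := by
    intro i j hi hj hjl
    obtain ⟨p, hp, hd, he⟩ := exists_overlap_eq S l d (s := s) (by omega)
    set k := overlap S l d s with hk
    have hend := H.end_lt p hp s hs hd
    have hIH := ih (d p) hd p rfl hp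
    obtain ⟨m, hm, hmax⟩ := Finset.exists_max_image (Finset.Ico (l p - k) (l p)) (b p)
      ⟨l p - k + i, by rw [Finset.mem_Ico]; omega⟩
    rw [Finset.mem_Ico] at hm
    -- The last position of `p` is fresh, as ends increase strictly with starts, and fresh positions
    -- carry larger values than covered ones. So the maximum sits in the block of `p`, where
    -- `rearrange` is explicit.
    have hmblock : overlap S l d p ≤ m := by
      by_contra hlt
      have h1 := hmax (l p - 1) (by rw [Finset.mem_Ico]; omega)
      have h2 := (H.right_lt_overlap_iff hp m).2 (by omega)
      have h3 := (H.right_lt_overlap_iff hp (l p - 1)).1 (by omega)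
      obtain ⟨r, hr, hrd, hre⟩ := exists_overlap_eq S l d (s := p) (by omega)
      have := H.end_lt r hr p hp hrd
      omega
    obtain ⟨i', hi1, hi2, hi3⟩ := H.max_eq p hp s hs k (by omega) hd he m hm.1 hm.2
      fun x hx hx' => hmax x (by rw [Finset.mem_Ico]; omega)
    have h1 : f (rearrange S l d a b (d s + i)) ≤ f (rearrange S l d a b (d p + m)) := by
      have := hIH m (by omega) (l p - k + i) (by omega)
      have h2 := hmax (l p - k + i) (by rw [Finset.mem_Ico]; omega)
      simp only [Function.comp] at this
      rw [show d p + (l p - k + i) = d s + i by omega] at this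
      omega
    -- The letter now at `d p + m` is the original letter at `d p + i'`, which lies in the prefix of
    -- `s`; there `a s` puts it below the block.
    rw [rearrange_of_mem_block H.inj hp hmblock (by omega), ← hi3,
      Equiv.symm_apply_apply] at h1
    refine h1.trans_lt ?_
    rw [rearrange_of_mem_block H.inj hs hj hjl,
      show d p + i' = d s + (i' + d p - d s) by omega,
      hf s hs _ (by omega) _ (H.symm_lt hs hjl), Equiv.apply_symm_apply]
    have h2 := H.left_lt_overlap_iff hs (i' + d p - d s)
    have h3 := H.right_lt_overlap_iff hs j
    omega
  intro i hi j hj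
  have hbi := H.right_lt_overlap_iff hs i
  have hbj := H.right_lt_overlap_iff hs j
  simp only [Function.comp]
  rcases lt_or_ge i (overlap S l d s) with hik | hik <;>
    rcases lt_or_ge j (overlap S l d s) with hjk | hjk
  · obtain ⟨p, hp, hd, he⟩ := exists_overlap_eq S l d (s := s) (by omega)
    have hend := H.end_lt p hp s hs hd
    have hIH := ih (d p) hd p rfl hp (l p - overlap S l d s + i) (by omega)
      (l p - overlap S l d s + j) (by omega)
    simp only [Function.comp] at hIH
    rw [show d p + (l p - overlap S l d s + i) = d s + i by omega,
      show d p + (l p - overlap S l d s + j) = d s + j by omega] at hIH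
    rw [hIH]
    exact H.overlap_right p hp s hs _ (by omega) hd he i hik j hjk
  · have := hcross i j hik hjk hj
    omega
  · have := hcross j i hjk hik hi
    omega
  · rw [rearrange_of_mem_block H.inj hs hik hi, rearrange_of_mem_block H.inj hs hjk hj,
      hf s hs _ (H.symm_lt hs hi) _ (H.symm_lt hs hj), Equiv.apply_symm_apply,
      Equiv.apply_symm_apply]

end Compatible

end Transport

/-! ### Counting -/

theorem hasOverlap_map {P Q : Set Pattern} (hmon : IsMonotone P) (φ : P ≃ Q)
    (hlen : ∀ π : P, len (φ π) = len π)
    (hlink : ∀ (π π' : P) (n : ℕ), HasLinkage π π' n ↔ HasLinkage (φ π) (φ π') n)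
    {π π' : P} {k : ℕ} (h : HasOverlap π π' k) : HasOverlap (φ π) (φ π') k := by
  obtain ⟨hk, hkl, hkl', -⟩ := (hasOverlap_iff _ _ _).1 h
  refine HasLinkage.hasOverlap (by rwa [hlen]) (by rwa [hlen]) ?_
  rw [hlen, hlen, ← hlink]
  exact h.hasLinkage (hmon.extend_lt π.2 π'.2 h)

/-- Only an inequality is needed, since the hypotheses on overlaps and maxima are symmetric under
exchanging the two collections. -/
theorem card_occursAt_le {P Q : Set Pattern} (hred : IsReduced P) (hmonP : IsMonotone P)
    (hmonQ : IsMonotone Q) (φ : P ≃ Q) (hlen : ∀ π : P, len (φ π) = len π)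
    (hov : ∀ (π π' : P) (k : ℕ), HasOverlap π π' k → HasOverlap (φ π) (φ π') k)
    (hmax : ∀ (π π' : P) (k : ℕ), HasOverlap π π' k →
      (finalSet π k).max = (finalSet (φ π) k).max)
    (n : ℕ) (S : Finset (P × ℕ)) :
    {σ : Equiv.Perm (Fin n) | ∀ s ∈ S, OccursAt s.1 σ s.2}.ncard ≤
      {σ : Equiv.Perm (Fin n) | ∀ s ∈ S, OccursAt (φ s.1) σ s.2}.ncard := by
  -- A witness `σ₀` makes the marked windows consistent: reducedness forbids nesting, and
  -- intersecting windows yield genuine overlaps.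
  rcases Set.eq_empty_or_nonempty {σ : Equiv.Perm (Fin n) | ∀ s ∈ S, OccursAt s.1 σ s.2}
    with he | ⟨σ₀, h₀⟩
  · rw [he, Set.ncard_empty]; exact Nat.zero_le _
  let l : P × ℕ → ℕ := fun s => len s.1
  let a : P × ℕ → Equiv.Perm ℕ := fun s => extend (s.1 : Pattern).2
  let b : P × ℕ → Equiv.Perm ℕ := fun s => extend (φ s.1 : Pattern).2
  have hend : ∀ s ∈ S, ∀ t ∈ S, s.2 < t.2 → s.2 + l s < t.2 + l t := by
    intro s hs t ht h
    by_contra hlt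
    have := hred _ t.1.2 _ s.1.2
      (divides_of_occursAt (h₀ s hs) (h₀ t ht) h.le (not_lt.1 hlt))
    simp only [l, this] at hlt
    omega
  have hO : ∀ s ∈ S, ∀ t ∈ S, ∀ k, 0 < k → s.2 < t.2 → s.2 + l s = t.2 + k →
      HasOverlap s.1 t.1 k := by
    intro s hs t ht k hk hd he
    have := hend s hs t ht hd
    exact hasOverlap_of_occursAt (h₀ s hs) (h₀ t ht) hk (by simp only [l] at he; omega)
      (by simp only [l] at *; omega) he.symm
  have H : Compatible S l Prod.snd a b :=
    { inj := by
        intro s hs t ht h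
        refine Prod.ext (Subtype.ext ?_) h
        rcases le_total (len s.1) (len t.1) with hle | hle
        · exact hred _ s.1.2 _ t.1.2
            (divides_of_occursAt (h₀ t ht) (h₀ s hs) h.ge (by omega))
        · exact (hred _ t.1.2 _ s.1.2
            (divides_of_occursAt (h₀ s hs) (h₀ t ht) h.le (by omega))).symm
      end_lt := hend
      lt_left := fun s _ i => extend_lt_iff _ i
      lt_right := fun s _ i => by
        simp only [l, ← hlen s.1]
        exact extend_lt_iff _ i
      init_left := fun s hs t ht k hk hd he =>
        hmonP.extend_lt s.1.2 t.1.2 (hO s hs t ht k hk hd he)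
      init_right := fun s hs t ht k hk hd he =>
        hmonQ.extend_lt (φ s.1).2 (φ t.1).2 (hov _ _ _ (hO s hs t ht k hk hd he))
      overlap_right := fun s hs t ht k hk hd he => by
        have := ((hasOverlap_iff _ _ _).1 (hov _ _ _ (hO s hs t ht k hk hd he))).2.2.2
        rwa [hlen] at this
      max_eq := fun s hs t ht k hk hd he m hm hml hmx => by
        -- The shift by one reconciles the 1-based entries of `finalSet` with the 0-based values of
        -- `b`.
        have hM : (finalSet (φ s.1) k).max = ((b s m + 1 : ℕ) : WithBot ℕ) := by
          refine le_antisymm (Finset.max_le fun e hx => ?_) (Finset.le_max ?_)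
          · obtain ⟨i, hi, hik, rfl⟩ := mem_finalSet.1 hx
            rw [hlen] at hi hik
            exact WithBot.coe_le_coe.2 (Nat.succ_le_succ (hmx i (by simp only [l]; omega) hi))
          · refine mem_finalSet.2 ⟨m, by rwa [hlen], by rw [hlen]; simp only [l] at hm; omega, rfl⟩
        rw [← hmax _ _ _ (hO s hs t ht k hk hd he)] at hM
        obtain ⟨i, hi, hik, hie⟩ := mem_finalSet.1 (Finset.mem_of_max hM)
        exact ⟨i, by simp only [l]; omega, hi, Nat.succ_injective hie⟩ }
  have hn : ∀ s ∈ S, s.2 + l s ≤ n := fun s hs => ((occursAt_iff _ _ _).1 (h₀ s hs)).1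
  obtain ⟨τ, hτ⟩ := exists_perm_extend_eq (n := n) (rearrange S l Prod.snd a b)
    (fun i hi => H.rearrange_lt hn hi) (fun i _ j _ hij => H.rearrange_injective hij)
  -- `τ` does not depend on `σ`, so injectivity is cancellation in the group.
  refine Set.ncard_le_ncard_of_injOn (fun σ => σ * τ) ?_
    (fun x _ y _ hxy => mul_right_cancel hxy) (Set.toFinite _)
  intro σ hσ s hs
  have hSO := H.sameOrder_rearrange (f := extend σ)
    (fun t ht => ((occursAt_iff _ _ _).1 (hσ t ht)).2) s hs
  refine (occursAt_iff _ _ _).2 ⟨by rw [hlen]; exact hn s hs, ?_⟩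
  have hmul : ∀ x < n, extend (σ * τ) x = extend σ (rearrange S l Prod.snd a b x) := by
    intro x hx
    rw [← hτ x hx, extend_apply τ hx, extend_fin, extend_apply _ hx]
    rfl
  intro i hi j hj
  rw [hlen] at hi hj
  have := hn s hs
  rw [hmul _ (by simp only [l] at this; omega), hmul _ (by simp only [l] at this; omega)]
  exact hSO i hi j hj

/-- Indexing occurrences in both collections by `P × ℕ` makes the two families of finite sets
comparable; the identity of `P` gives the case of `P` itself. -/
theorem ncard_occurrences {P Q : Set Pattern} (φ : P ≃ Q) {n : ℕ} (σ : Equiv.Perm (Fin n)) :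
    {s : P × ℕ | OccursAt (φ s.1) σ s.2}.ncard = (occurrences Q σ).ncard ∧
      {s : P × ℕ | OccursAt (φ s.1) σ s.2}.Finite := by
  let f : P × ℕ → Pattern × ℕ := fun s => ((φ s.1 : Pattern), s.2)
  have hf : Function.Injective f := by
    rintro ⟨s, i⟩ ⟨t, j⟩ h
    simp only [f, Prod.mk.injEq] at h
    exact Prod.ext (φ.injective (Subtype.ext h.1)) h.2
  have himg : f '' {s : P × ℕ | OccursAt (φ s.1) σ s.2} = occurrences Q σ := by
    ext ⟨π, i⟩
    constructor
    · rintro ⟨s, hs, he⟩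
      rw [← he]
      exact ⟨(φ s.1).2, hs⟩
    · rintro ⟨hπ, ho⟩
      refine ⟨(φ.symm ⟨π, hπ⟩, i), ?_, ?_⟩
      · simpa using ho
      · simp [f]
  rw [← himg, Set.ncard_image_of_injective _ hf]
  refine ⟨rfl, Set.Finite.of_finite_image ?_ hf.injOn⟩
  rw [himg]
  exact occurrences_finite Q σ

theorem countWith_eq_of_ncard_eq {P Q : Set Pattern} (φ : P ≃ Q) (n : ℕ)
    (h : ∀ S : Finset (P × ℕ), {σ : Equiv.Perm (Fin n) | ∀ s ∈ S, OccursAt s.1 σ s.2}.ncard =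
      {σ : Equiv.Perm (Fin n) | ∀ s ∈ S, OccursAt (φ s.1) σ s.2}.ncard) (q : ℕ) :
    countWith P n q = countWith Q n q := by
  classical
  have hP := fun σ : Equiv.Perm (Fin n) => ncard_occurrences (Equiv.refl P) σ
  have hQ := fun σ : Equiv.Perm (Fin n) => ncard_occurrences φ σ
  have key := card_filter_card_eq (fun σ => (hP σ).2.toFinset) (fun σ => (hQ σ).2.toFinset)
    (fun S => by
      have hS := h S
      rw [Set.ncard_eq_toFinset_card', Set.ncard_eq_toFinset_card'] at hS
      convert hS using 2 <;>
      · ext σ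
        simp [Finset.subset_iff]) q
  unfold countWith
  rw [Set.ncard_eq_toFinset_card', Set.ncard_eq_toFinset_card']
  convert key using 2 <;> ext σ
  · rw [Set.mem_toFinset, Set.mem_ofPred_eq, mem_filter, ← Set.ncard_eq_toFinset_card _ (hP σ).2,
      (hP σ).1]
    simp
  · rw [Set.mem_toFinset, Set.mem_ofPred_eq, mem_filter, ← Set.ncard_eq_toFinset_card _ (hQ σ).2,
      (hQ σ).1]
    simp

end CWilf

theorem corollary3p4 (P₁ P₂ : Set CWilf.Pattern)
    (hred₁ : CWilf.IsReduced P₁) (hred₂ : CWilf.IsReduced P₂)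
    (hmon₁ : CWilf.IsMonotone P₁) (hmon₂ : CWilf.IsMonotone P₂)
    (φ : P₁ ≃ P₂)
    (hlen : ∀ π : P₁, CWilf.len (φ π) = CWilf.len π)
    (hlink : ∀ (π π' : P₁) (n : ℕ),
      CWilf.HasLinkage π π' n ↔ CWilf.HasLinkage (φ π) (φ π') n)
    (hmax : ∀ (π π' : P₁) (k : ℕ), CWilf.HasOverlap π π' k →
      (CWilf.finalSet π k).max = (CWilf.finalSet (φ π) k).max) :
    CWilf.StronglyCWilfEquivalent P₁ P₂ ∧
      ∀ (π π' : P₁) (k : ℕ), CWilf.HasOverlap π π' k →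
        CWilf.initialSet π' k = Finset.Icc 1 k ∧
          CWilf.initialSet (φ π') k = Finset.Icc 1 k := by
  have hlen' : ∀ ρ : P₂, CWilf.len (φ.symm ρ) = CWilf.len ρ := fun ρ => by
    simpa using (hlen (φ.symm ρ)).symm
  have hov : ∀ (π π' : P₁) (k : ℕ), CWilf.HasOverlap π π' k →
      CWilf.HasOverlap (φ π) (φ π') k :=
    fun _ _ _ h => CWilf.hasOverlap_map hmon₁ φ hlen hlink h
  have hov' : ∀ (ρ ρ' : P₂) (k : ℕ), CWilf.HasOverlap ρ ρ' k →
      CWilf.HasOverlap (φ.symm ρ) (φ.symm ρ') k :=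
    fun _ _ _ h => CWilf.hasOverlap_map hmon₂ φ.symm hlen'
      (fun ρ ρ' n => by simpa using (hlink (φ.symm ρ) (φ.symm ρ') n).symm) h
  refine ⟨fun n _ q _ => CWilf.countWith_eq_of_ncard_eq φ n (fun S => ?_) q,
    fun π π' k h => ⟨hmon₁.initialSet_eq π.2 π'.2 h,
      hmon₂.initialSet_eq (φ π).2 (φ π').2 (hov _ _ _ h)⟩⟩
  refine le_antisymm (CWilf.card_occursAt_le hred₁ hmon₁ hmon₂ φ hlen hov hmax n S) ?_
  have h := CWilf.card_occursAt_le hred₂ hmon₂ hmon₁ φ.symm hlen' hov'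
    (fun ρ ρ' k h => by simpa using (hmax _ _ k (hov' ρ ρ' k h)).symm) n
    (S.map (φ.prodCongr (Equiv.refl ℕ)).toEmbedding)
  have hS' : ∀ p : P₂ → ℕ → Prop,
      (∀ s ∈ S.map (φ.prodCongr (Equiv.refl ℕ)).toEmbedding, p s.1 s.2) ↔
        ∀ s ∈ S, p (φ s.1) s.2 := fun p => by
    rw [Finset.forall_mem_map]
    rfl
  refine (congrArg Set.ncard (Set.ext fun σ => ?_)).trans_le
    (h.trans_eq (congrArg Set.ncard (Set.ext fun σ => ?_)))
  · exact (hS' fun ρ i => CWilf.OccursAt ρ σ i).symm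
  · refine (hS' fun ρ i => CWilf.OccursAt (φ.symm ρ) σ i).trans ?_
    simp only [Equiv.symm_apply_apply]
    rfl
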